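/- For a finite simple graph $G$, let $\rho(G)$ denote the spectral radius of its adjacency matrix (equivalently, its largest adjacency eigenvalue), and let $G^2$ denote the square of $G$, that is, the graph on the same vertex set in which two distinct vertices are adjacent if and only if their distance in $G$ is at most $2$. Let $P_n$ be the path on $n$ vertices. Let $G$ be a connected simple graph of order $n\ge 4$. Then $$\rho(G^2)\ \ge\ \rho(P_n^2),$$ with equality if and only if $G$ is isomorphic to $P_n$. -/

import Mathlib

/-- The `k`-th power `G^k` of a simple graph: two distinct vertices are adjacent when their
distance in `G` is at most `k` (the extended distance is `⊤` between different components). -/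
def graphPower {V : Type*} (G : SimpleGraph V) (k : ℕ) : SimpleGraph V where
  Adj u v := u ≠ v ∧ G.edist u v ≤ (k : ℕ∞)
  symm := ⟨fun u v h => ⟨h.1.symm, by rw [SimpleGraph.edist_comm]; exact h.2⟩⟩
  loopless := ⟨fun _ h => h.1 rfl⟩

open Classical in
/-- The spectral radius `ρ(G)` of a finite simple graph: the spectral radius (largest modulus of a
complex eigenvalue) of its adjacency matrix, as an extended nonnegative real. It is finite, since
the spectrum is a finite set. -/
noncomputable def graphSpectralRadius {V : Type*} [Fintype V] [DecidableEq V]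
    (G : SimpleGraph V) : ENNReal :=
  spectralRadius ℂ (G.adjMatrix ℂ)

/-! List the path outwards from its centre. Every vertex `k ≥ 4` then has exactly two earlier
neighbours in the square, `k - 2` and `k - 4`, while 2 and 3 have 0 and 1. In this listing the
closed-neighbourhood matrix `A + I` preserves the cone of nonnegative nonincreasing vectors, so it
has an eigenvector `z` there, which is in fact positive (`exists_antitone_eigenvector`).

The vertices of any connected `G` can be listed so that each `k ≥ 2` has two earlier neighbours in
`G²` at positions no later than those of the path (`SimpleGraph.Connected.exists_ordering`,
`exists_two_lower_neighbours`). With `z` as test vector, the quadratic form of `G²` dominates that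
of the path square term by term, and the Rayleigh quotient gives the inequality.

Since `z` is positive, a third earlier neighbour anywhere makes the comparison strict. Equality
therefore excludes one, and this forces `G` to be a path (`adj_iff_of_no_three_lower_neighbours`).
-/

/-! ### Bounds on the spectral radius -/

open Matrix in
open scoped Matrix.Norms.L2Operator Classical in
/-- The Rayleigh quotient of a real vector is bounded by the spectral radius. -/
theorem exists_nnreal_graphSpectralRadius {V : Type*} [Fintype V] [DecidableEq V]
    (G : SimpleGraph V) : ∃ r : NNReal, graphSpectralRadius G = r ∧
      ∀ x : V → ℝ, ∑ i, ∑ j, (if G.Adj i j then x i * x j else 0) ≤ r * ∑ i, x i ^ 2 := by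
  have hA : IsSelfAdjoint (G.adjMatrix ℂ) := by
    ext i j
    simp [Matrix.star_apply, SimpleGraph.adjMatrix_apply, G.adj_comm i j]
  refine ⟨‖G.adjMatrix ℂ‖₊, ?_, fun x => ?_⟩
  · unfold graphSpectralRadius
    exact hA.spectralRadius_eq_nnnorm
  · set T := toEuclideanCLM (n := V) (𝕜 := ℂ) (G.adjMatrix ℂ) with hT
    set y : EuclideanSpace ℂ V := WithLp.toLp 2 (fun i => (x i : ℂ)) with hy
    have h1 : ‖(inner ℂ y (T y) : ℂ)‖ ≤ ‖T‖ * ‖y‖ ^ 2 := by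
      calc _ ≤ ‖y‖ * ‖T y‖ := norm_inner_le_norm _ _
        _ ≤ ‖y‖ * (‖T‖ * ‖y‖) := by gcongr; exact T.le_opNorm y
        _ = _ := by ring
    have h2 : (inner ℂ y (T y) : ℂ)
        = ((∑ i, ∑ j, (if G.Adj i j then x i * x j else 0) : ℝ) : ℂ) := by
      rw [PiLp.inner_apply]
      push_cast
      refine Finset.sum_congr rfl fun i _ => ?_
      simp only [hT, hy, toEuclideanCLM_toLp, mulVec, dotProduct, SimpleGraph.adjMatrix_apply]
      rw [RCLike.inner_apply, Finset.sum_mul]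
      refine Finset.sum_congr rfl fun j _ => ?_
      split_ifs <;> simp [mul_comm]
    have h3 : ‖y‖ ^ 2 = ∑ i, x i ^ 2 := by
      rw [EuclideanSpace.norm_sq_eq]
      simp [hy]
    rw [h2, h3, Complex.norm_real] at h1
    exact (le_abs_self _).trans h1

open Classical in
/-- A positive eigenvector bounds the spectral radius by its eigenvalue. -/
theorem graphSpectralRadius_le_of_pos_eigenvector {V : Type*} [Fintype V] [DecidableEq V]
    (G : SimpleGraph V) (z : V → ℝ) (hz : ∀ i, 0 < z i) (c : ℝ)
    (h : ∀ i, ∑ j, (if G.Adj i j then z j else 0) = c * z i) :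
    graphSpectralRadius G ≤ ENNReal.ofReal c := by
  unfold graphSpectralRadius spectralRadius
  refine iSup₂_le fun μ hμ => ?_
  rw [Matrix.mem_spectrum_iff_isRoot_charpoly, ← Matrix.charpoly_toLin',
    ← Module.End.hasEigenvalue_iff_isRoot_charpoly] at hμ
  obtain ⟨v, hv⟩ := hμ.exists_hasEigenvector
  have hv1 := hv.apply_eq_smul
  have key : ∀ i, ‖μ‖ * ‖v i‖ ≤ ∑ j, (if G.Adj i j then ‖v j‖ else 0) := by
    intro i
    have := congrFun hv1 i
    simp only [Matrix.toLin'_apply, Matrix.mulVec, dotProduct, SimpleGraph.adjMatrix_apply,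
      Pi.smul_apply, smul_eq_mul] at this
    rw [← norm_mul, ← this]
    refine (norm_sum_le _ _).trans (Finset.sum_le_sum fun j _ => ?_)
    split_ifs <;> simp
  have hpos : 0 < ∑ i, z i * ‖v i‖ := by
    obtain ⟨i, hi⟩ := Function.ne_iff.mp hv.2
    exact Finset.sum_pos' (fun i _ => mul_nonneg (hz i).le (norm_nonneg _))
      ⟨i, Finset.mem_univ _, mul_pos (hz i) (norm_pos_iff.mpr hi)⟩
  -- Pair the entrywise inequality with `z`; symmetry moves the adjacency matrix onto `z`, where it
  -- acts as `c`.
  have hle : ‖μ‖ * ∑ i, z i * ‖v i‖ ≤ c * ∑ i, z i * ‖v i‖ := by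
    calc ‖μ‖ * ∑ i, z i * ‖v i‖ = ∑ i, z i * (‖μ‖ * ‖v i‖) := by
          rw [Finset.mul_sum]; exact Finset.sum_congr rfl fun i _ => by ring
      _ ≤ ∑ i, z i * ∑ j, (if G.Adj i j then ‖v j‖ else 0) :=
          Finset.sum_le_sum fun i _ => mul_le_mul_of_nonneg_left (key i) (hz i).le
      _ = ∑ j, (∑ i, (if G.Adj j i then z i else 0)) * ‖v j‖ := by
          simp_rw [Finset.mul_sum, Finset.sum_mul]
          rw [Finset.sum_comm]
          refine Finset.sum_congr rfl fun j _ => Finset.sum_congr rfl fun i _ => ?_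
          rw [G.adj_comm i j]
          split_ifs <;> simp
      _ = c * ∑ i, z i * ‖v i‖ := by
          rw [Finset.mul_sum]
          exact Finset.sum_congr rfl fun i _ => by rw [h i]; ring
  have := le_of_mul_le_mul_right hle hpos
  rw [← ENNReal.ofReal_coe_nnreal, coe_nnnorm]
  exact ENNReal.ofReal_le_ofReal this

theorem graphSpectralRadius_congr {V W : Type*} [Fintype V] [DecidableEq V] [Fintype W]
    [DecidableEq W] {G : SimpleGraph V} {H : SimpleGraph W} (φ : G ≃g H) :
    graphSpectralRadius G = graphSpectralRadius H := by
  classical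
  have : Matrix.reindexAlgEquiv ℂ ℂ φ.toEquiv (G.adjMatrix ℂ) = H.adjMatrix ℂ := by
    ext i j
    simp only [Matrix.coe_reindexAlgEquiv, Matrix.reindex_apply, Matrix.submatrix_apply,
      SimpleGraph.adjMatrix_apply]
    congr 1
    exact propext (φ.symm.map_rel_iff' (a := i) (b := j))
  have h2 := AlgEquiv.spectrum_eq (Matrix.reindexAlgEquiv ℂ ℂ φ.toEquiv) (G.adjMatrix ℂ)
  rw [this] at h2
  have h3 : spectralRadius ℂ (G.adjMatrix ℂ) = spectralRadius ℂ (H.adjMatrix ℂ) := by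
    simp only [spectralRadius, h2]
  unfold graphSpectralRadius
  convert h3

/-! ### Eigenvectors in an invariant cone -/

/-- A symmetric operator preserving a nontrivial closed pointed cone has an eigenvector in it. -/
theorem exists_eigenvector_mem_cone {E : Type*} [NormedAddCommGroup E] [InnerProductSpace ℝ E]
    [FiniteDimensional ℝ E] (T : E →L[ℝ] E) (hT : ∀ x y, inner ℝ (T x) y = inner ℝ x (T y))
    (K : Set E) (hK : IsClosed K) (hadd : ∀ x ∈ K, ∀ y ∈ K, x + y ∈ K)
    (hsmul : ∀ c : ℝ, 0 ≤ c → ∀ x ∈ K, c • x ∈ K) (hpt : ∀ x ∈ K, -x ∈ K → x = 0)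
    (hTK : ∀ x ∈ K, T x ∈ K) (hne : ∃ x ∈ K, x ≠ 0) :
    ∃ z ∈ K, z ≠ 0 ∧ ∃ c : ℝ, T z = c • z := by
  obtain ⟨x₀, hx₀, hx₀'⟩ := hne
  have hcomp : IsCompact (K ∩ Metric.sphere (0 : E) 1) := (isCompact_sphere 0 1).inter_left hK
  have hnon : (K ∩ Metric.sphere (0 : E) 1).Nonempty :=
    ⟨‖x₀‖⁻¹ • x₀, hsmul _ (by positivity) _ hx₀, by simp [norm_smul, hx₀']⟩
  obtain ⟨z, ⟨hzK, hz1⟩, hmax⟩ := hcomp.exists_isMaxOn hnon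
    (f := fun x => ‖T x‖) (by fun_prop)
  have hz1 : ‖z‖ = 1 := by simpa using hz1
  have hz0 : z ≠ 0 := by rintro rfl; simp at hz1
  set l := ‖T z‖ with hl
  have hl0 : 0 ≤ l := norm_nonneg _
  have hbound : ∀ w ∈ K, ‖T w‖ ≤ l * ‖w‖ := by
    intro w hw
    by_cases hw0 : w = 0
    · simp [hw0]
    have hp : 0 < ‖w‖ := norm_pos_iff.mpr hw0
    have : ‖T (‖w‖⁻¹ • w)‖ ≤ l :=
      hmax ⟨hsmul _ (by positivity) _ hw, by simp [norm_smul, hw0]⟩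
    rw [map_smul, norm_smul, norm_inv, norm_norm, inv_mul_le_iff₀ hp] at this
    linarith
  -- Equality case of Cauchy–Schwarz: `⟨T²z, z⟩ = ‖Tz‖² = l²`, while `‖T²z‖ ≤ l‖Tz‖ = l²` and `‖z‖ =
  -- 1`.
  have hsq : T (T z) = (l ^ 2) • z := by
    have h1 : ‖T (T z)‖ ≤ l ^ 2 := by
      have := hbound (T z) (hTK z hzK)
      rw [← hl] at this
      nlinarith
    have h2 : inner ℝ (T (T z)) z = l ^ 2 := by
      rw [hT, real_inner_self_eq_norm_sq]
    have h3 : ‖T (T z) - (l ^ 2) • z‖ ^ 2 ≤ 0 := by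
      rw [norm_sub_sq_real, inner_smul_right, h2, norm_smul, hz1]
      have : ‖l ^ 2‖ = l ^ 2 := by rw [Real.norm_of_nonneg (by positivity)]
      rw [this]
      have := norm_nonneg (T (T z))
      nlinarith
    have h4 : ‖T (T z) - (l ^ 2) • z‖ = 0 := by
      have := sq_nonneg ‖T (T z) - (l ^ 2) • z‖
      exact pow_eq_zero_iff (two_ne_zero) |>.mp (le_antisymm h3 this)
    exact sub_eq_zero.mp (norm_eq_zero.mp h4)
  -- `T² - l²` factors as `(T - l)(T + l)`, so `Tz + lz` is an eigenvector unless it vanishes; in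
  -- that case pointedness gives `Tz = 0`.
  by_cases hu : T z + l • z = 0
  · have h5 : T z = 0 := by
      apply hpt _ (hTK z hzK)
      rw [neg_eq_of_add_eq_zero_right hu]
      exact hsmul l hl0 z hzK
    exact ⟨z, hzK, hz0, 0, by simp [h5]⟩
  · refine ⟨_, hadd _ (hTK z hzK) _ (hsmul l hl0 z hzK), hu, l, ?_⟩
    rw [map_add, map_smul, hsq, smul_add, smul_smul, sq, add_comm]

/-! ### Graph squares and vertex orderings -/

theorem graphPower_two_adj {V : Type*} (G : SimpleGraph V) (u v : V) :
    (graphPower G 2).Adj u v ↔ u ≠ v ∧ (G.Adj u v ∨ ∃ w, G.Adj u w ∧ G.Adj w v) := by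
  refine and_congr_right fun hne => ⟨fun h => ?_, ?_⟩
  · obtain ⟨p, hp⟩ := SimpleGraph.exists_walk_of_edist_ne_top
      (ne_top_of_le_ne_top (by simp) h)
    rw [← hp] at h
    have hlen : p.length ≤ 2 := by exact_mod_cast h
    match p, hlen with
    | .nil, _ => exact absurd rfl hne
    | .cons h1 .nil, _ => exact Or.inl h1
    | .cons h1 (.cons h2 .nil), _ => exact Or.inr ⟨_, h1, h2⟩
    | .cons h1 (.cons h2 (.cons h3 q)), hlen =>
      simp only [SimpleGraph.Walk.length_cons] at hlen; omega
  · rintro (h | ⟨w, h1, h2⟩)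
    · exact (SimpleGraph.edist_le (.cons h .nil)).trans (by simp)
    · exact (SimpleGraph.edist_le (.cons h1 (.cons h2 .nil))).trans (by simp)

/-- Some vertex other than a given one can be removed without disconnecting the graph. -/
theorem SimpleGraph.Connected.exists_ne_connected_induce {V : Type*} [Finite V] [Nontrivial V]
    {G : SimpleGraph V} (hG : G.Connected) (w : V) :
    ∃ u, u ≠ w ∧ (G.induce {v | v ≠ u}).Connected := by
  -- A vertex farthest from `w` is interior to no geodesic issuing from `w`.
  obtain ⟨u, hu⟩ := Finite.exists_max (fun v => G.dist w v)
  have huw : u ≠ w := by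
    rintro rfl
    obtain ⟨v, hv⟩ := exists_ne u
    have := hu v
    rw [SimpleGraph.dist_self] at this
    exact hv.symm ((hG.dist_eq_zero_iff).mp (by omega))
  refine ⟨u, huw, ?_⟩
  have key : ∀ d, ∀ v (hv : v ≠ u), G.dist w v = d →
      (G.induce {v | v ≠ u}).Reachable ⟨w, huw.symm⟩ ⟨v, hv⟩ := by
    intro d
    induction d with
    | zero =>
      intro v hv h
      have := (hG.dist_eq_zero_iff).mp h
      subst this
      rfl
    | succ d ih =>
      intro v hv h
      obtain ⟨p, hp⟩ := hG.exists_walk_length_eq_dist v w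
      rw [SimpleGraph.dist_comm, h] at hp
      match p, hp with
      | .cons (v := x) h1 q, hp =>
        simp only [SimpleGraph.Walk.length_cons] at hp
        have hx1 : G.dist w x ≤ d := by
          rw [SimpleGraph.dist_comm]; exact (SimpleGraph.dist_le q).trans (by omega)
        have hx2 : G.dist w v ≤ G.dist w x + 1 := by
          have := hG.dist_triangle (u := w) (v := x) (w := v)
          rw [SimpleGraph.dist_eq_one_iff_adj.mpr h1.symm] at this
          exact this
        have hxu : x ≠ u := by
          rintro rfl
          have := hu v
          omega
        refine (ih x hxu (by omega)).trans (SimpleGraph.Adj.reachable ?_)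
        exact h1.symm
  have : Nonempty {v | v ≠ u} := ⟨⟨w, huw.symm⟩⟩
  exact ⟨fun a b => (key _ a.1 a.2 rfl).symm.trans (key _ b.1 b.2 rfl)⟩

/-- The vertices of a connected graph can be listed so that the first two are adjacent and every
later vertex has a neighbour among those listed before its immediate predecessor. -/
theorem SimpleGraph.Connected.exists_ordering (n : ℕ) : ∀ {V : Type*} [Fintype V]
    (G : SimpleGraph V), G.Connected → Fintype.card V = n + 2 → ∀ w : V,
    ∃ f : ℕ → V, Set.InjOn f (Set.Iio (n + 2)) ∧ G.Adj (f 1) (f 0) ∧ f (n + 1) ≠ w ∧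
      ∀ k, 2 ≤ k → k < n + 2 → ∃ j, j + 2 ≤ k ∧ G.Adj (f k) (f j) := by
  induction n with
  | zero =>
    intro V _ G hG hc w
    have : Nontrivial V := Fintype.one_lt_card_iff_nontrivial.mp (by omega)
    obtain ⟨u, hu⟩ := exists_ne w
    obtain ⟨x, hx⟩ := hG.preconnected.exists_adj_of_nontrivial u
    refine ⟨fun k => if k = 0 then x else u, ?_, by simpa using hx, by simpa using hu,
      fun k _ _ => by omega⟩
    intro a ha b hb hab
    simp only [Set.mem_Iio] at ha hb
    dsimp only at hab
    split_ifs at hab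
    · omega
    · exact absurd hab hx.ne'
    · exact absurd hab hx.ne
    · omega
  | succ n ih =>
    intro V _ G hG hc w
    classical
    have : Nontrivial V := Fintype.one_lt_card_iff_nontrivial.mp (by omega)
    obtain ⟨u, huw, hu⟩ := hG.exists_ne_connected_induce w
    obtain ⟨x, hx⟩ := hG.preconnected.exists_adj_of_nontrivial u
    have hcard : Fintype.card {v | v ≠ u} = n + 2 := by
      simp only [Set.coe_ofPred, Fintype.card_subtype_compl]
      simp [hc]
    -- The listing of `G - u` must not end at the neighbour `x` of `u`: then `u` can be appended
    -- with `x` before its immediate predecessor.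
    obtain ⟨f, hf1, hf2, hf3, hf4⟩ := ih (G.induce {v | v ≠ u}) hu hcard ⟨x, hx.ne'⟩
    have hsurj : ∃ j, j < n + 2 ∧ f j = ⟨x, hx.ne'⟩ := by
      have := Finset.surj_on_of_inj_on_of_card_le (s := Finset.range (n + 2))
        (t := Finset.univ) (fun i _ => f i) (by simp)
        (fun a b ha hb h => hf1 (by simpa using ha) (by simpa using hb) h)
        (by simpa using hcard.le) ⟨x, hx.ne'⟩ (by simp)
      obtain ⟨j, hj, h⟩ := this
      exact ⟨j, by simpa using hj, h.symm⟩
    obtain ⟨j, hj, hjx⟩ := hsurj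
    have hj' : j ≠ n + 1 := by rintro rfl; exact hf3 hjx
    refine ⟨fun k => if k < n + 2 then (f k : V) else u, ?_, ?_, ?_, ?_⟩
    · intro a ha b hb hab
      simp only [Set.mem_Iio] at ha hb
      dsimp only at hab
      split_ifs at hab with h1 h2 h2
      · exact hf1 h1 h2 (Subtype.ext hab)
      · exact absurd hab (f a).2
      · exact absurd hab.symm (f b).2
      · omega
    · simpa using hf2
    · simpa using huw
    · intro k hk hk'
      rcases Nat.lt_or_ge k (n + 2) with h | h
      · obtain ⟨i, hi, hadj⟩ := hf4 k hk h
        refine ⟨i, hi, ?_⟩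
        simp only [if_pos h, if_pos (show i < n + 2 by omega)]
        exact hadj
      · refine ⟨j, by omega, ?_⟩
        simp only [if_neg (show ¬ k < n + 2 by omega), if_pos hj, hjx]
        exact hx

/-! ### The path square listed from its centre -/

/-- The vertices of the path `0, …, n - 1`, listed outwards from its centre. -/
def centerOut (n k : ℕ) : ℕ := if k % 2 = 0 then (n - 1) / 2 - k / 2 else (n - 1) / 2 + (k + 1) / 2

theorem centerOut_lt {n k : ℕ} (h : k < n) : centerOut n k < n := by
  unfold centerOut; split_ifs <;> omega

/-- The listing `centerOut` as a permutation. -/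
noncomputable def centerOutEquiv (n : ℕ) : Fin n ≃ Fin n :=
  Equiv.ofBijective (fun i => ⟨centerOut n i, centerOut_lt i.2⟩) <| by
    rw [← Finite.injective_iff_bijective]
    intro i j h
    have := congrArg Fin.val h
    simp only [centerOut] at this
    ext
    split_ifs at this <;> omega

@[simp] theorem centerOutEquiv_val {n : ℕ} (i : Fin n) :
    (centerOutEquiv n i : ℕ) = centerOut n i := rfl

/-- The closed neighbourhood of the `k`-th vertex in the square of a path listed by `centerOut`. -/
def centerOutNbhd : ℕ → Finset ℕ
  | 0 => {0, 1, 2, 3, 4}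
  | 1 => {0, 1, 2, 3, 5}
  | 2 => {0, 1, 2, 4, 6}
  | 3 => {0, 1, 3, 5, 7}
  | k + 4 => {k, k + 2, k + 4, k + 6, k + 8}

theorem mem_centerOutNbhd_self (k : ℕ) : k ∈ centerOutNbhd k := by
  match k with
  | 0 | 1 | 2 | 3 => simp [centerOutNbhd]
  | k + 4 => simp [centerOutNbhd]

theorem mem_centerOutNbhd_comm (i j : ℕ) : j ∈ centerOutNbhd i ↔ i ∈ centerOutNbhd j := by
  match i, j with
  | 0, 0 | 0, 1 | 0, 2 | 0, 3 | 1, 0 | 1, 1 | 1, 2 | 1, 3 | 2, 0 | 2, 1 | 2, 2 | 2, 3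
  | 3, 0 | 3, 1 | 3, 2 | 3, 3 => simp [centerOutNbhd]
  | 0, j + 4 | 1, j + 4 | 2, j + 4 | 3, j + 4 => simp [centerOutNbhd]; try omega
  | i + 4, 0 | i + 4, 1 | i + 4, 2 | i + 4, 3 => simp [centerOutNbhd]; try omega
  | i + 4, j + 4 => simp [centerOutNbhd]; omega

theorem pathGraph_adj_centerOut {n : ℕ} (i j : Fin n) :
    (SimpleGraph.pathGraph n).Adj (centerOutEquiv n i) (centerOutEquiv n j) ↔
      (i : ℕ) + 2 = j ∨ (j : ℕ) + 2 = i ∨ ((i : ℕ) = 0 ∧ (j : ℕ) = 1) ∨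
        ((i : ℕ) = 1 ∧ (j : ℕ) = 0) := by
  have hi := i.2
  have hj := j.2
  rw [SimpleGraph.pathGraph_adj]
  simp only [centerOutEquiv_val, centerOut]
  split_ifs <;> omega

theorem graphPower_pathGraph_adj {n : ℕ} (i j : Fin n) :
    (graphPower (SimpleGraph.pathGraph n) 2).Adj i j ↔
      i ≠ j ∧ (i : ℕ) ≤ j + 2 ∧ (j : ℕ) ≤ i + 2 := by
  rw [graphPower_two_adj]
  refine and_congr_right fun hne => ?_
  have hi := i.2
  have hj := j.2
  have hne' : (i : ℕ) ≠ j := fun h => hne (Fin.ext h)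
  simp only [SimpleGraph.pathGraph_adj]
  constructor
  · rintro (h | ⟨w, h1, h2⟩) <;> omega
  · rintro ⟨h1, h2⟩
    by_cases h : (i : ℕ) + 1 = j ∨ (j : ℕ) + 1 = i
    · exact Or.inl h
    · refine Or.inr ⟨⟨((i : ℕ) + j) / 2, by omega⟩, ?_, ?_⟩ <;> simp only <;> omega

/-- The square of the path on `n` vertices, relabelled by `centerOut`. -/
noncomputable def centerOutSquare (n : ℕ) : SimpleGraph (Fin n) :=
  (graphPower (SimpleGraph.pathGraph n) 2).comap (centerOutEquiv n)

theorem centerOutSquare_adj {n : ℕ} (i j : Fin n) :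
    (centerOutSquare n).Adj i j ↔
      i ≠ j ∧ (j : ℕ) ∈ centerOutNbhd i := by
  rw [centerOutSquare, SimpleGraph.comap_adj, graphPower_pathGraph_adj, (centerOutEquiv n).injective.ne_iff]
  refine and_congr_right fun hne => ?_
  obtain ⟨i, hi⟩ := i
  obtain ⟨j, hj⟩ := j
  simp only [centerOutEquiv_val, centerOut]
  match i with
  | 0 | 1 | 2 | 3 =>
    simp only [centerOutNbhd, Finset.mem_insert, Finset.mem_singleton]
    split_ifs <;> first | contradiction | omega
  | i + 4 =>
    simp only [centerOutNbhd, Finset.mem_insert, Finset.mem_singleton]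
    split_ifs <;> omega

/-- From `k` to `k + 1`, the `i`-th smallest member of the neighbourhood never decreases. The
neighbourhoods must be closed: without the vertex itself, this already fails between 0 and 1. -/
theorem antitone_sum_centerOutNbhd {z : ℕ → ℝ} (hz : Antitone z) :
    Antitone fun k => ∑ j ∈ centerOutNbhd k, z j := by
  refine antitone_nat_of_succ_le fun k => ?_
  match k with
  | 0 => simp [centerOutNbhd]; linarith [hz (show 4 ≤ 5 by omega)]
  | 1 => simp [centerOutNbhd]; linarith [hz (show 3 ≤ 4 by omega), hz (show 5 ≤ 6 by omega)]
  | 2 =>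
    simp [centerOutNbhd]
    linarith [hz (show 2 ≤ 3 by omega), hz (show 4 ≤ 5 by omega), hz (show 6 ≤ 7 by omega)]
  | 3 =>
    simp [centerOutNbhd]
    linarith [hz (show 1 ≤ 2 by omega), hz (show 3 ≤ 4 by omega), hz (show 5 ≤ 6 by omega),
      hz (show 7 ≤ 8 by omega)]
  | k + 4 =>
    simp [centerOutNbhd]
    linarith [hz (show k ≤ k + 1 by omega), hz (show k + 2 ≤ k + 3 by omega),
      hz (show k + 4 ≤ k + 5 by omega), hz (show k + 6 ≤ k + 7 by omega),
      hz (show k + 8 ≤ k + 9 by omega)]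

theorem sum_fin_ite_mem {n : ℕ} {z : ℕ → ℝ} (hz : ∀ k, n ≤ k → z k = 0) (s : Finset ℕ) :
    ∑ j : Fin n, (if (j : ℕ) ∈ s then z j else 0) = ∑ j ∈ s, z j := by
  rw [Fin.sum_univ_eq_sum_range (fun j => if j ∈ s then z j else 0) n, ← Finset.sum_filter]
  refine Finset.sum_subset (fun j hj => (Finset.mem_filter.mp hj).2) fun j hj hj' => ?_
  refine hz j ?_
  by_contra h
  exact hj' (by simp [hj]; omega)

/-- The square of a path has a positive eigenvector that decreases outwards from the centre. -/
theorem exists_antitone_eigenvector {n : ℕ} (hn : 2 ≤ n) : ∃ z : ℕ → ℝ, Antitone z ∧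
    (∀ k, k < n → 0 < z k) ∧ (∀ k, n ≤ k → z k = 0) ∧ ∃ c : ℝ, 1 < c ∧
      ∀ k, k < n → ∑ j ∈ centerOutNbhd k, z j = c * z k := by
  let M : Matrix (Fin n) (Fin n) ℝ := Matrix.of fun i j => if (j : ℕ) ∈ centerOutNbhd i then 1 else 0
  let T := Matrix.toEuclideanCLM (n := Fin n) (𝕜 := ℝ) M
  -- `centerOutNbhd` ignores the ends of the path, so vectors are extended by zero; nonnegativity
  -- keeps the extension antitone.
  let ext : EuclideanSpace ℝ (Fin n) → ℕ → ℝ := fun x k => if h : k < n then x ⟨k, h⟩ else 0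
  have hextz : ∀ x, ∀ k, n ≤ k → ext x k = 0 := fun x k h => dif_neg (by omega)
  have hextv : ∀ x, ∀ i : Fin n, ext x i = x i := fun x i => dif_pos i.2
  have hTx : ∀ x, ∀ i : Fin n, T x i = ∑ j ∈ centerOutNbhd i, ext x j := by
    intro x i
    rw [← sum_fin_ite_mem (hextz x)]
    show (M.mulVec x.ofLp) i = _
    simp only [Matrix.mulVec, dotProduct, M, Matrix.of_apply]
    refine Finset.sum_congr rfl fun j _ => ?_
    rw [hextv]
    split_ifs <;> simp
  let K : Set (EuclideanSpace ℝ (Fin n)) := {x | (∀ i j, i ≤ j → x j ≤ x i) ∧ ∀ i, 0 ≤ x i}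
  have hanti : ∀ x ∈ K, Antitone (ext x) := by
    intro x hx a b hab
    by_cases hb : b < n
    · simp only [ext, dif_pos hb, dif_pos (lt_of_le_of_lt hab hb)]
      exact hx.1 _ _ hab
    · rw [hextz x b (by omega)]
      simp only [ext]
      split_ifs
      · exact hx.2 _
      · exact le_rfl
  have hpos0 : ∀ x ∈ K, ∀ k, 0 ≤ ext x k := by
    intro x hx k
    simp only [ext]
    split_ifs
    · exact hx.2 _
    · exact le_rfl
  obtain ⟨x, hxK, hx0, c, hc⟩ := exists_eigenvector_mem_cone T (fun x y => by
      rw [PiLp.inner_apply, PiLp.inner_apply]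
      have h1 : ∀ x, ∀ i, T x i = ∑ j, M i j * x j := fun x i => rfl
      simp only [h1, RCLike.inner_apply, conj_trivial, Finset.mul_sum, Finset.sum_mul]
      rw [Finset.sum_comm]
      refine Finset.sum_congr rfl fun i _ => Finset.sum_congr rfl fun j _ => ?_
      have : M i j = M j i := by
        simp only [M, Matrix.of_apply, mem_centerOutNbhd_comm (i : ℕ) j]
      rw [this]; ring) K
    (by
      have : K = (⋂ i, ⋂ j, ⋂ _ : i ≤ j, {x : EuclideanSpace ℝ (Fin n) | x j ≤ x i}) ∩
          ⋂ i, {x : EuclideanSpace ℝ (Fin n) | 0 ≤ x i} := by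
        ext x; simp [K]
      rw [this]
      refine IsClosed.inter (isClosed_iInter fun i => isClosed_iInter fun j =>
        isClosed_iInter fun _ => isClosed_le (by fun_prop) (by fun_prop))
        (isClosed_iInter fun i => isClosed_le (by fun_prop) (by fun_prop)))
    (fun x hx y hy => ⟨fun i j h => add_le_add (hx.1 i j h) (hy.1 i j h),
      fun i => add_nonneg (hx.2 i) (hy.2 i)⟩)
    (fun a ha x hx => ⟨fun i j h => mul_le_mul_of_nonneg_left (hx.1 i j h) ha,
      fun i => mul_nonneg ha (hx.2 i)⟩)
    (fun x hx hx' => by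
      ext i
      have h1 := hx.2 i
      have h2 := hx'.2 i
      simp only [PiLp.neg_apply] at h2
      simp only [PiLp.zero_apply]
      linarith)
    (fun x hx => ⟨fun i j h => by
      rw [hTx, hTx]; exact antitone_sum_centerOutNbhd (hanti x hx) h,
      fun i => by rw [hTx]; exact Finset.sum_nonneg fun j _ => hpos0 x hx j⟩)
    ⟨WithLp.toLp 2 (fun _ => 1), ⟨fun _ _ _ => le_rfl, fun _ => zero_le_one⟩, fun h => by
      have := congrArg (fun y : EuclideanSpace ℝ (Fin n) => y ⟨0, by omega⟩) h
      simp at this⟩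
  have heig : ∀ k, k < n → ∑ j ∈ centerOutNbhd k, ext x j = c * ext x k := by
    intro k hk
    have := hTx x ⟨k, hk⟩
    rw [hc] at this
    rw [← this]
    simp only [ext, dif_pos hk, PiLp.smul_apply, smul_eq_mul]
  have hle : ∀ k j, j ∈ centerOutNbhd k → ext x j ≤ ∑ j ∈ centerOutNbhd k, ext x j :=
    fun k j hj => Finset.single_le_sum (fun i _ => hpos0 x hxK i) hj
  have hpos : ∀ k, k < n → 0 < ext x k := by
    intro k
    induction k using Nat.strong_induction_on with
    | _ k ih =>
      intro hk
      rcases Nat.eq_zero_or_pos k with rfl | hk0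
      · refine lt_of_le_of_ne (hpos0 x hxK 0) fun h => hx0 ?_
        ext i
        have h1 := hanti x hxK (Nat.zero_le i)
        rw [← h, hextv] at h1
        exact le_antisymm h1 (hxK.2 i)
      -- A zero at `k` would, by the eigenvalue equation, force a zero at the earlier neighbour `j`.
      · obtain ⟨j, hj, hjk⟩ : ∃ j ∈ centerOutNbhd k, j < k := by
          match k with
          | 0 => omega
          | 1 | 2 | 3 => exact ⟨0, by simp [centerOutNbhd], by omega⟩
          | k + 4 => exact ⟨k, by simp [centerOutNbhd], by omega⟩
        have h1 := hle k j hj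
        rw [heig k hk] at h1
        have h2 := ih j hjk (by omega)
        refine lt_of_le_of_ne (hpos0 x hxK k) fun h => ?_
        rw [← h] at h1
        linarith
  refine ⟨ext x, hanti x hxK, hpos, hextz x, c, ?_, heig⟩
  -- The row of vertex 0 contains `z 0 + z 1` with both terms positive, so `c > 1`.
  have h0 := heig 0 (by omega)
  simp [centerOutNbhd] at h0
  have := hpos 0 (by omega)
  have := hpos 1 (by omega)
  have := hpos0 x hxK 2
  have := hpos0 x hxK 3
  have := hpos0 x hxK 4
  nlinarith

/-! ### Comparison of earlier neighbours -/

/-- In the square of a path listed by `centerOut`, the neighbours preceding `k` carry at most the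
weight of any two vertices `a`, `b` listed early enough. -/
theorem lowerNbhd_sum_le {z : ℕ → ℝ} (hz : Antitone z) {k a b : ℕ} (hk : 2 ≤ k)
    (ha : a ≤ max 1 (k - 2)) (hb : b ≤ k - 4) :
    ∑ j ∈ (centerOutNbhd k).filter (· < k), z j ≤ z a + z b := by
  match k with
  | 0 | 1 => omega
  | 2 =>
    have : (centerOutNbhd 2).filter (· < 2) = {0, 1} := by decide
    rw [this]
    have := hz (show a ≤ 1 by omega)
    have := hz (show b ≤ 0 by omega)
    simp; linarith
  | 3 =>
    have : (centerOutNbhd 3).filter (· < 3) = {0, 1} := by decide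
    rw [this]
    have := hz (show a ≤ 1 by omega)
    have := hz (show b ≤ 0 by omega)
    simp; linarith
  | k + 4 =>
    have : (centerOutNbhd (k + 4)).filter (· < k + 4) = {k, k + 2} := by
      ext j; simp [centerOutNbhd]; omega
    rw [this]
    have := hz (show a ≤ k + 2 by omega)
    have := hz (show b ≤ k by omega)
    simp; linarith

open Classical in
/-- The quadratic form of a graph on `Fin n`, summed over pairs in increasing order. -/
theorem sum_adj_mul_eq_two_mul {n : ℕ} (H : SimpleGraph (Fin n)) (z : Fin n → ℝ) :
    ∑ i, ∑ j, (if H.Adj i j then z i * z j else 0)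
      = 2 * ∑ i, z i * ∑ j, (if j < i ∧ H.Adj i j then z j else 0) := by
  have h1 : ∀ i j, (if H.Adj i j then z i * z j else 0)
      = z i * (if j < i ∧ H.Adj i j then z j else 0)
        + z j * (if i < j ∧ H.Adj j i then z i else 0) := by
    intro i j
    rw [H.adj_comm j i]
    rcases lt_trichotomy i j with h | rfl | h
    · simp [h, h.not_gt, mul_comm]
    · simp
    · simp [h, h.not_gt]
  simp_rw [h1, Finset.sum_add_distrib]
  rw [Finset.sum_comm (f := fun i j => z j * (if i < j ∧ H.Adj j i then z i else 0))]
  simp_rw [← Finset.mul_sum]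
  ring

/-- If `G` is listed so that `v₁ ~ v₀` and every later vertex has a neighbour before its immediate
predecessor, then every vertex has two early preceding neighbours in the square of `G`. -/
theorem exists_two_lower_neighbours {V : Type*} {G : SimpleGraph V} {f : ℕ → V} {n : ℕ}
    (hf : Set.InjOn f (Set.Iio n)) (h10 : G.Adj (f 1) (f 0))
    (hpar : ∀ k, 2 ≤ k → k < n → ∃ j, j + 2 ≤ k ∧ G.Adj (f k) (f j)) {k : ℕ} (hk : 2 ≤ k)
    (hkn : k < n) : ∃ a b, b < a ∧ a < k ∧ a ≤ max 1 (k - 2) ∧ b ≤ k - 4 ∧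
      (graphPower G 2).Adj (f k) (f a) ∧ (graphPower G 2).Adj (f k) (f b) := by
  have hne : ∀ j, j < k → f k ≠ f j := fun j hj h =>
    hj.ne' (hf (Set.mem_Iio.mpr hkn) (Set.mem_Iio.mpr (by omega)) h)
  obtain ⟨p, hp, hadj⟩ := hpar k hk hkn
  simp only [graphPower_two_adj]
  rcases (by omega : p = 0 ∨ p = 1 ∨ 2 ≤ p) with rfl | rfl | h2
  · exact ⟨1, 0, by omega, by omega, by omega, by omega, ⟨hne _ (by omega), Or.inr ⟨_, hadj, h10.symm⟩⟩,
      ⟨hne _ (by omega), Or.inl hadj⟩⟩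
  · exact ⟨1, 0, by omega, by omega, by omega, by omega, ⟨hne _ (by omega), Or.inl hadj⟩,
      ⟨hne _ (by omega), Or.inr ⟨_, hadj, h10⟩⟩⟩
  -- The two neighbours are the parent `p ≤ k - 2` and its own parent `q ≤ p - 2 ≤ k - 4`.
  · obtain ⟨q, hq, hadj'⟩ := hpar p h2 (by omega)
    exact ⟨p, q, by omega, by omega, by omega, by omega, ⟨hne _ (by omega), Or.inl hadj⟩,
      ⟨hne _ (by omega), Or.inr ⟨_, hadj, hadj'⟩⟩⟩

/-- If moreover no vertex has three preceding neighbours in the square, then `G` is a path listed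
outwards from its centre. -/
theorem adj_iff_of_no_three_lower_neighbours {V : Type*} {G : SimpleGraph V} {f : ℕ → V} {n : ℕ}
    (hn : 4 ≤ n) (hf : Set.InjOn f (Set.Iio n)) (h10 : G.Adj (f 1) (f 0))
    (hpar : ∀ k, 2 ≤ k → k < n → ∃ j, j + 2 ≤ k ∧ G.Adj (f k) (f j))
    (h3 : ∀ k a b c, 2 ≤ k → k < n → a < k → b < k → c < k → a ≠ b → a ≠ c → b ≠ c →
      (graphPower G 2).Adj (f k) (f a) → (graphPower G 2).Adj (f k) (f b) →
      (graphPower G 2).Adj (f k) (f c) → False) {k j : ℕ} (hk : 2 ≤ k) (hkn : k < n) (hj : j < k) :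
    G.Adj (f k) (f j) ↔ j + 2 = k := by
  have hne : ∀ k j, j < k → k < n → f k ≠ f j := fun k j hj hkn h =>
    hj.ne' (hf (Set.mem_Iio.mpr hkn) (Set.mem_Iio.mpr (by omega)) h)
  have R1 : ∀ {k j}, j < k → k < n → G.Adj (f k) (f j) → (graphPower G 2).Adj (f k) (f j) :=
    fun hj hk h => (graphPower_two_adj _ _ _).mpr ⟨hne _ _ hj hk, Or.inl h⟩
  have R2 : ∀ {k j} w, j < k → k < n → G.Adj (f k) (f w) → G.Adj (f w) (f j) →
      (graphPower G 2).Adj (f k) (f j) :=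
    fun w hj hk h h' => (graphPower_two_adj _ _ _).mpr ⟨hne _ _ hj hk, Or.inr ⟨_, h, h'⟩⟩
  have step : ∀ k, 2 ≤ k → k < n → G.Adj (f k) (f (k - 2)) := by
    intro k
    induction k using Nat.strong_induction_on with
    | _ k ih =>
      intro hk hkn
      obtain ⟨p, hp, hadj⟩ := hpar k hk hkn
      rcases (by omega : p = k - 2 ∨ p + 2 < k) with rfl | hpk
      · exact hadj
      -- If `p < k - 2`, then `p`, its later neighbour `p + 2` and a further neighbour `q` of `p`
      -- are three earlier neighbours of `k` in the square.
      have hsib : G.Adj (f p) (f (p + 2)) := (ih (p + 2) hpk (by omega) (by omega)).symm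
      obtain ⟨q, hqp, hq2, hq⟩ : ∃ q, q ≠ p ∧ q < p + 2 ∧ G.Adj (f p) (f q) := by
        rcases (by omega : p = 0 ∨ p = 1 ∨ 2 ≤ p) with rfl | rfl | h2
        · exact ⟨1, by omega, by omega, h10.symm⟩
        · exact ⟨0, by omega, by omega, h10⟩
        · exact ⟨p - 2, by omega, by omega, ih p (by omega) h2 (by omega)⟩
      exact (h3 k p (p + 2) q hk hkn (by omega) hpk (by omega) (by omega) hqp.symm (by omega)
        (R1 (by omega) hkn hadj) (R2 p hpk hkn hadj hsib) (R2 p (by omega) hkn hadj hq)).elim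
  refine ⟨fun h => ?_, fun h => by
    obtain rfl : j = k - 2 := by omega
    exact step k hk hkn⟩
  by_contra hjk
  have hk2 := step k hk hkn
  rcases (by omega : k = 2 ∨ k = 3 ∨ 4 ≤ k) with rfl | rfl | h4
  -- A triangle on 0, 1, 2 gives no third earlier neighbour at 2 itself; the contradiction appears
  -- at vertex 3, which exists because `n ≥ 4`.
  · obtain rfl : j = 1 := by omega
    have h31 := step 3 (by omega) (by omega)
    exact h3 3 0 1 2 (by omega) (by omega) (by omega) (by omega) (by omega) (by omega) (by omega)
      (by omega) (R2 1 (by omega) (by omega) h31 h10) (R1 (by omega) (by omega) h31)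
      (R2 1 (by omega) (by omega) h31 h.symm)
  · have h20 := step 2 (by omega) (by omega)
    have r1 := R1 (by omega) hkn hk2
    have r0 := R2 1 (show 0 < 3 by omega) hkn hk2 h10
    rcases (by omega : j = 0 ∨ j = 2) with rfl | rfl
    · exact h3 3 0 1 2 hk hkn (by omega) (by omega) (by omega) (by omega) (by omega) (by omega)
        r0 r1 (R2 0 (by omega) hkn h h20.symm)
    · exact h3 3 0 1 2 hk hkn (by omega) (by omega) (by omega) (by omega) (by omega) (by omega)
        r0 r1 (R1 (by omega) hkn h)
  · have r2 := R1 (by omega) hkn hk2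
    have r4 := R2 (k - 2) (show k - 2 - 2 < k by omega) hkn hk2 (step (k - 2) (by omega) (by omega))
    have rj := R1 hj hkn h
    by_cases hj4 : j = k - 2 - 2
    · obtain ⟨q, hqj, hq2, hq⟩ : ∃ q, q ≠ j ∧ q < j + 2 ∧ G.Adj (f j) (f q) := by
        rcases (by omega : j = 0 ∨ j = 1 ∨ 2 ≤ j) with rfl | rfl | h2
        · exact ⟨1, by omega, by omega, h10.symm⟩
        · exact ⟨0, by omega, by omega, h10⟩
        · exact ⟨j - 2, by omega, by omega, step j h2 (by omega)⟩
      exact h3 k (k - 2) j q hk hkn (by omega) (by omega) (by omega) (by omega) (by omega) (by omega)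
        r2 rj (R2 j (by omega) hkn h hq)
    · exact h3 k (k - 2) (k - 2 - 2) j hk hkn (by omega) (by omega) (by omega) (by omega) (by omega)
        (by omega) r2 r4 rj

/-! ### Quadratic forms and the main theorem -/

theorem SimpleGraph.Iso.graphPower_two {V W : Type*} {G : SimpleGraph V} {H : SimpleGraph W}
    (φ : G ≃g H) : Nonempty (graphPower G 2 ≃g graphPower H 2) := by
  refine ⟨⟨φ.toEquiv, fun {a b} => ?_⟩⟩
  rw [graphPower_two_adj, graphPower_two_adj]
  refine and_congr (φ.toEquiv.injective.ne_iff) (or_congr φ.map_rel_iff' ?_)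
  rw [← φ.toEquiv.exists_congr_right]
  exact exists_congr fun w => and_congr φ.map_rel_iff' φ.map_rel_iff'

open Classical in
theorem sum_lower_adj_pathGraph {n : ℕ} {z : ℕ → ℝ} (hz : ∀ k, n ≤ k → z k = 0) (i : Fin n) :
    ∑ j : Fin n, (if j < i ∧ (centerOutSquare n).Adj i j then z j else 0)
      = ∑ j ∈ (centerOutNbhd i).filter (· < (i : ℕ)), z j := by
  rw [← sum_fin_ite_mem hz]
  refine Finset.sum_congr rfl fun j _ => if_congr ?_ rfl rfl
  rw [centerOutSquare_adj, Finset.mem_filter, Fin.lt_def,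
    ne_comm]
  constructor
  · rintro ⟨h1, -, h2⟩; exact ⟨h2, h1⟩
  · rintro ⟨h2, h1⟩; exact ⟨h1, fun h => h1.ne (congrArg Fin.val h), h2⟩

open Classical in
theorem sum_adj_pathGraph {n : ℕ} {z : ℕ → ℝ} (hz : ∀ k, n ≤ k → z k = 0) (i : Fin n) :
    ∑ j : Fin n, (if (centerOutSquare n).Adj i j then z j else 0) = ∑ j ∈ centerOutNbhd i, z j - z i := by
  rw [← sum_fin_ite_mem hz, eq_sub_iff_add_eq]
  have h : z i = ∑ j : Fin n, if j = i then z j else 0 := by simp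
  rw [h, ← Finset.sum_add_distrib]
  refine Finset.sum_congr rfl fun j _ => ?_
  rw [centerOutSquare_adj]
  by_cases hij : j = i
  · subst hij; simp [mem_centerOutNbhd_self]
  · simp [hij, Ne.symm hij]

theorem sum_le_sum_ite {ι : Type*} [Fintype ι] (s : Finset ι) (p : ι → Prop) [DecidablePred p]
    {w : ι → ℝ} (hs : ∀ j ∈ s, p j) (hw : ∀ j, 0 ≤ w j) :
    ∑ j ∈ s, w j ≤ ∑ j, if p j then w j else 0 := by
  rw [← Finset.sum_filter]
  exact Finset.sum_le_sum_of_subset_of_nonneg (fun j hj => by simpa using hs j hj)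
    fun j _ _ => hw j

theorem corollary3p6 {V : Type*} [Fintype V] [DecidableEq V] (n : ℕ) (hn : 4 ≤ n)
    (hV : Fintype.card V = n) (G : SimpleGraph V) (hG : G.Connected) :
    graphSpectralRadius (graphPower (SimpleGraph.pathGraph n) 2)
        ≤ graphSpectralRadius (graphPower G 2) ∧
      (graphSpectralRadius (graphPower G 2)
          = graphSpectralRadius (graphPower (SimpleGraph.pathGraph n) 2) ↔
        Nonempty (G ≃g SimpleGraph.pathGraph n)) := by
  classical
  obtain ⟨m, rfl⟩ : ∃ m, n = m + 2 := ⟨n - 2, by omega⟩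
  obtain ⟨w⟩ := hG.nonempty
  obtain ⟨f, hf, h10, -, hpar⟩ := hG.exists_ordering m G hV w
  obtain ⟨z, hz, hzpos, hz0, c, hc, heig⟩ := exists_antitone_eigenvector (show 2 ≤ m + 2 by omega)
  set n := m + 2
  let φ : Fin n ≃ V := Equiv.ofBijective (fun i => f i) <| by
    rw [Fintype.bijective_iff_injective_and_card]
    exact ⟨fun i j h => Fin.ext (hf i.2 j.2 h), by simp [hV]⟩
  have hφ : ∀ i, φ i = f i := fun i => rfl
  let H := (graphPower G 2).comap φ
  let P := centerOutSquare n
  have hHρ : graphSpectralRadius H = graphSpectralRadius (graphPower G 2) :=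
    graphSpectralRadius_congr (SimpleGraph.Iso.comap φ _)
  have hPρ : graphSpectralRadius P = graphSpectralRadius (graphPower (SimpleGraph.pathGraph n) 2) :=
    graphSpectralRadius_congr (SimpleGraph.Iso.comap (centerOutEquiv n) _)
  rw [← hHρ, ← hPρ]
  have hPle : graphSpectralRadius P ≤ ENNReal.ofReal (c - 1) := by
    refine graphSpectralRadius_le_of_pos_eigenvector P (fun i => z i) (fun i => hzpos i i.2) _
      fun i => ?_
    rw [sum_adj_pathGraph hz0, heig i i.2]
    ring
  obtain ⟨r, hr, hray⟩ := exists_nnreal_graphSpectralRadius H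
  have hray := hray fun i => z i
  have hPform : ∑ i : Fin n, ∑ j : Fin n, (if P.Adj i j then z i * z j else 0)
      = (c - 1) * ∑ i : Fin n, z i ^ 2 := by
    rw [Finset.mul_sum]
    refine Finset.sum_congr rfl fun i _ => ?_
    have := sum_adj_pathGraph hz0 i
    rw [heig i i.2] at this
    simp_rw [← mul_ite_zero, ← Finset.mul_sum]
    rw [this]; ring
  have hsq : 0 < ∑ i : Fin n, z i ^ 2 :=
    Finset.sum_pos (fun i _ => pow_pos (hzpos i i.2) 2) ⟨⟨0, by omega⟩, Finset.mem_univ _⟩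
  rw [sum_adj_mul_eq_two_mul H fun i => z i] at hray
  rw [sum_adj_mul_eq_two_mul P fun i => z i] at hPform
  have hterm : ∀ i : Fin n, ∑ j : Fin n, (if j < i ∧ P.Adj i j then z j else 0)
      ≤ ∑ j : Fin n, (if j < i ∧ H.Adj i j then z j else 0) := by
    intro i
    rw [sum_lower_adj_pathGraph hz0]
    obtain ⟨i, hi⟩ := i
    rcases (by omega : i = 0 ∨ i = 1 ∨ 2 ≤ i) with rfl | rfl | h
    · simp
    · have h1 : (centerOutNbhd 1).filter (· < 1) = {0} := by decide
      have h2 := sum_le_sum_ite {⟨0, Nat.succ_pos _⟩} (fun j => j < (⟨1, hi⟩ : Fin n) ∧ H.Adj ⟨1, hi⟩ j)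
        (w := fun j => z j) (by
          simp only [Finset.mem_singleton, forall_eq]
          exact ⟨zero_lt_one, (graphPower_two_adj _ _ _).mpr ⟨h10.ne, Or.inl h10⟩⟩) fun j => (hzpos j j.2).le
      rw [Finset.sum_singleton] at h2
      refine le_trans (le_of_eq ?_) h2
      show ∑ j ∈ (centerOutNbhd 1).filter (· < 1), z j = z 0
      rw [h1, Finset.sum_singleton]
    · obtain ⟨a, b, hba, hak, ha, hb, ra, rb⟩ := exists_two_lower_neighbours hf h10 hpar h hi
      refine (lowerNbhd_sum_le hz h ha hb).trans ?_
      have h2 := sum_le_sum_ite {⟨a, by omega⟩, ⟨b, by omega⟩}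
        (fun j => j < (⟨i, hi⟩ : Fin n) ∧ H.Adj ⟨i, hi⟩ j) (w := fun j => z j) (by
          simp only [Finset.mem_insert, Finset.mem_singleton, forall_eq_or_imp, forall_eq]
          exact ⟨⟨hak, ra⟩, hba.trans hak, rb⟩) fun j => (hzpos j j.2).le
      rwa [Finset.sum_pair (by simp; omega)] at h2
  have hstrict : ∀ k a b c, 2 ≤ k → k < n → a < k → b < k → c < k → a ≠ b → a ≠ c → b ≠ c →
      (graphPower G 2).Adj (f k) (f a) → (graphPower G 2).Adj (f k) (f b) →
      (graphPower G 2).Adj (f k) (f c) → ∃ i : Fin n,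
      ∑ j : Fin n, (if j < i ∧ P.Adj i j then z j else 0)
      < ∑ j : Fin n, (if j < i ∧ H.Adj i j then z j else 0) := by
    intro k a' b' c' hk hkn ha' hb' hc' hab hac hbc ra' rb' rc'
    obtain ⟨a, b, hba, hak, ha, hb, ra, rb⟩ := exists_two_lower_neighbours hf h10 hpar hk hkn
    -- Of three distinct earlier neighbours, at least one differs from both `a` and `b`; its
    -- positive weight is the surplus.
    obtain ⟨d, hdk, hda, hdb, rd⟩ : ∃ d, d < k ∧ a ≠ d ∧ b ≠ d ∧
        (graphPower G 2).Adj (f k) (f d) := by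
      by_cases h1 : a ≠ a' ∧ b ≠ a'
      · exact ⟨a', ha', h1.1, h1.2, ra'⟩
      by_cases h2 : a ≠ b' ∧ b ≠ b'
      · exact ⟨b', hb', h2.1, h2.2, rb'⟩
      exact ⟨c', hc', by omega, by omega, rc'⟩
    refine ⟨⟨k, hkn⟩, ?_⟩
    rw [sum_lower_adj_pathGraph hz0]
    refine (lowerNbhd_sum_le hz hk ha hb).trans_lt ?_
    have h2 := sum_le_sum_ite {⟨a, by omega⟩, ⟨b, by omega⟩, ⟨d, by omega⟩}
      (fun j => j < (⟨k, hkn⟩ : Fin n) ∧ H.Adj ⟨k, hkn⟩ j) (w := fun j => z j) (by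
        simp only [Finset.mem_insert, Finset.mem_singleton, forall_eq_or_imp, forall_eq]
        exact ⟨⟨hak, ra⟩, ⟨hba.trans hak, rb⟩, hdk, rd⟩) fun j => (hzpos j j.2).le
    rw [Finset.sum_insert (by simp; omega), Finset.sum_pair (by simp; omega)] at h2
    have := hzpos d (by omega)
    exact lt_of_lt_of_le (by dsimp only; linarith) h2
  have hle : ENNReal.ofReal (c - 1) ≤ r := by
    rw [← ENNReal.ofReal_coe_nnreal]
    refine ENNReal.ofReal_le_ofReal (le_of_mul_le_mul_right (le_trans ?_ hray) hsq)
    rw [← hPform]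
    refine mul_le_mul_of_nonneg_left (Finset.sum_le_sum fun i _ => ?_) zero_le_two
    exact mul_le_mul_of_nonneg_left (hterm i) (hzpos i i.2).le
  refine ⟨hPle.trans (hr ▸ hle), fun heq => ?_, fun ⟨ψ⟩ => ?_⟩
  · have hno : ¬ ∃ i : Fin n, ∑ j : Fin n, (if j < i ∧ P.Adj i j then z j else 0)
        < ∑ j : Fin n, (if j < i ∧ H.Adj i j then z j else 0) := by
      rintro ⟨i₀, hi₀⟩
      have hlt : c - 1 < r := by
        refine lt_of_mul_lt_mul_right (lt_of_lt_of_le ?_ hray) hsq.le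
        rw [← hPform]
        refine mul_lt_mul_of_pos_left (Finset.sum_lt_sum (fun i _ => ?_)
          ⟨i₀, Finset.mem_univ _, mul_lt_mul_of_pos_left hi₀ (hzpos _ i₀.2)⟩) zero_lt_two
        exact mul_le_mul_of_nonneg_left (hterm i) (hzpos i i.2).le
      -- `ENNReal.ofReal` is strictly monotone only towards a positive value; `c > 1` makes `r`
      -- positive.
      have h1 : ENNReal.ofReal (c - 1) < r := by
        rw [← ENNReal.ofReal_coe_nnreal]
        exact (ENNReal.ofReal_lt_ofReal_iff (by linarith)).mpr hlt
      rw [← hr, heq] at h1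
      exact absurd hPle h1.not_ge
    have hadj : ∀ {k j : ℕ}, 2 ≤ k → k < n → j < k → (G.Adj (f k) (f j) ↔ j + 2 = k) :=
      adj_iff_of_no_three_lower_neighbours hn hf h10 hpar
        fun k a b c h1 h2 h3 h4 h5 h6 h7 h8 r1 r2 r3 =>
          hno (hstrict k a b c h1 h2 h3 h4 h5 h6 h7 h8 r1 r2 r3)
    have hlow : ∀ i j : Fin n, (j : ℕ) < i → (G.Adj (φ i) (φ j) ↔
        (SimpleGraph.pathGraph n).Adj (centerOutEquiv n i) (centerOutEquiv n j)) := by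
      intro i j hij
      rw [pathGraph_adj_centerOut, hφ, hφ]
      rcases Nat.lt_or_ge i 2 with h | h
      · have hi1 : (i : ℕ) = 1 := by omega
        have hj0 : (j : ℕ) = 0 := by omega
        rw [hi1, hj0]
        simp [h10]
      · rw [hadj h i.2 hij]
        omega
    refine ⟨⟨φ.symm.trans (centerOutEquiv n), fun {a b} => ?_⟩⟩
    obtain ⟨i, rfl⟩ := φ.surjective a
    obtain ⟨j, rfl⟩ := φ.surjective b
    simp only [Equiv.trans_apply, Equiv.symm_apply_apply]
    rcases lt_trichotomy (i : ℕ) j with h | h | h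
    · rw [SimpleGraph.adj_comm, G.adj_comm, hlow j i h]
    · rw [Fin.ext h]; simp
    · rw [hlow i j h]
  · rw [hHρ, hPρ]
    obtain ⟨ψ₂⟩ := ψ.graphPower_two
    exact graphSpectralRadius_congr ψ₂
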